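/- **Theorem (necessary second-order optimality conditions).** Let $d\in\{2,3\}$, let $\Omega\subset\mathbb{R}^d$ be open and bounded (in particular, any bounded Lipschitz domain is allowed; no regularity of $\partial\Omega$ is needed), let $\alpha>0$, $0<\mathsf{a}<\mathsf{b}$, $\mathbf{y}_\Omega\in\mathbf{L}^2(\Omega)$ and $\mathbf{f}\in\mathbf{H}^{-1}(\Omega)=\mathbf{H}^1_0(\Omega)'$. Put $\mathbf{V}(\Omega)=\{\mathbf{v}\in\mathbf{H}_0^1(\Omega):\operatorname{div}\mathbf{v}=0\}$ and let $$\mathbb{U}_{ad}=\{u\in L^2(\Omega):\mathsf{a}\le u\le\mathsf{b}\text{ a.e. in }\Omega\}\subset L^\infty(\Omega).$$ For $u\in\mathcal{U}=\{u\in L^\infty(\Omega): u\ge c \text{ a.e. for some } c>0\}$ let $\mathbf{y}_u\in\mathbf{V}(\Omega)$ be the velocity of the Stokes--Brinkman equations $-\Delta\mathbf{y}+u\mathbf{y}+\nabla\mathsf{p}=\mathbf{f}$, $\operatorname{div}\mathbf{y}=0$ in $\Omega$, $\mathbf{y}=0$ on $\partial\Omega$, that is, the unique element of $\mathbf{V}(\Omega)$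 with $$(\nabla\mathbf{y}_u,\nabla\mathbf{w})_{\mathbf{L}^2(\Omega)}+(u\,\mathbf{y}_u,\mathbf{w})_{\mathbf{L}^2(\Omega)}=\langle\mathbf{f},\mathbf{w}\rangle\qquad\forall\,\mathbf{w}\in\mathbf{V}(\Omega),$$ and let $\mathbf{z}_u\in\mathbf{V}(\Omega)$ be the adjoint velocity, i.e. the unique solution of the same problem with right-hand side $(\mathbf{y}_u-\mathbf{y}_\Omega,\mathbf{w})_{\mathbf{L}^2(\Omega)}$. Let $j:\mathcal{U}\to\mathbb{R}$, $$j(u)=\tfrac12\|\mathbf{y}_u-\mathbf{y}_\Omega\|_{\mathbf{L}^2(\Omega)}^2+\tfrac{\alpha}{2}\|u\|_{L^2(\Omega)}^2 .$$ Let $\bar u\in\mathbb{U}_{ad}$ be locally optimal in $L^2(\Omega)$: there is $\delta>0$ such that $j(\bar u)\le j(u)$ for all $u\in\mathbb{U}_{ad}$ with $\|u-\bar u\|_{L^2(\Omega)}\le\delta$. Write $\bar{\mathbf{y}}=\mathbf{y}_{\bar u}$, $\bar{\mathbf{z}}=\mathbf{z}_{\bar u}$, and let $C_{\bar u}$ be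 the cone of all $v\in L^2(\Omega)$ such that, for a.e. $x\in\Omega$, $$v(x)\ge0\text{ if }\bar u(x)=\mathsf{a},\qquad v(x)\le0\text{ if }\bar u(x)=\mathsf{b},\qquad v(x)=0\text{ if }\alpha\bar u(x)-\bar{\mathbf{y}}(x)\cdot\bar{\mathbf{z}}(x)\ne0 .$$ Then $j$ is of class $C^2$ near $\bar u$ with respect to the $L^\infty(\Omega)$-topology, its second derivative $j''(\bar u)$ extends uniquely to a continuous bilinear form on $L^2(\Omega)\times L^2(\Omega)$ (again denoted by $j''(\bar u)$), and $$j''(\bar u)v^2\ge 0\qquad\text{for all } v\in C_{\bar u}.$$ -/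

import Mathlib

open MeasureTheory Set Filter Topology
open scoped ENNReal ContDiff RealInnerProductSpace

noncomputable section

namespace Brinkman

variable {d : ℕ}

/-- The Euclidean space `ℝ^d`. -/
abbrev Space (d : ℕ) : Type := EuclideanSpace ℝ (Fin d)

/-- `L^2(Ω)`. -/
abbrev L2 (Ω : Set (Space d)) : Type := Lp ℝ 2 (volume.restrict Ω)

/-- `L^∞(Ω)`, the space of controls. -/
abbrev LInf (Ω : Set (Space d)) : Type := Lp ℝ ∞ (volume.restrict Ω)

/-- Square integrable vector fields on `Ω`. -/
abbrev VecL2 (Ω : Set (Space d)) : Type := Lp (Space d) 2 (volume.restrict Ω)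

/-- Pairs `(y, (∂₁ y, …, ∂_d y))` of a vector field and its partial derivatives, all in `L^2`, with
the Hilbert space norm `(‖y‖^2 + ∑ i, ‖∂ᵢ y‖^2)^(1/2)` of `H^1`. -/
abbrev Jet (Ω : Set (Space d)) : Type :=
  WithLp 2 (VecL2 Ω × PiLp 2 (fun _ : Fin d => VecL2 Ω))

/-- Vector-valued test functions, i.e. smooth with compact support contained in `Ω`. -/
def IsTestField (Ω : Set (Space d)) (φ : Space d → Space d) : Prop :=
  ContDiff ℝ ∞ φ ∧ HasCompactSupport φ ∧ tsupport φ ⊆ Ω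

/-- The pairs `(φ, ∇φ)` with `φ` a test field. -/
def testJets (Ω : Set (Space d)) : Set (Jet Ω) :=
  {p | ∃ φ : Space d → Space d, IsTestField Ω φ ∧
    (p.fst =ᵐ[volume.restrict Ω] φ) ∧
    ∀ i, p.snd i =ᵐ[volume.restrict Ω] fun x => fderiv ℝ φ x (EuclideanSpace.single i 1)}

/-- The closure of the test fields in the norm of `H^1`. -/
def h01 (Ω : Set (Space d)) : Submodule ℝ (Jet Ω) :=
  (Submodule.span ℝ (testJets Ω)).topologicalClosure

/-- The Sobolev space `H_0^1(Ω)` of vector fields, the closure of the test fields in the norm of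
`H^1`. Its elements consist of a field and of its weak partial derivatives. -/
def H01 (Ω : Set (Space d)) : Type := h01 Ω

instance (Ω : Set (Space d)) : NormedAddCommGroup (H01 Ω) :=
  inferInstanceAs (NormedAddCommGroup (h01 Ω))

instance (Ω : Set (Space d)) : InnerProductSpace ℝ (H01 Ω) :=
  inferInstanceAs (InnerProductSpace ℝ (h01 Ω))

instance (Ω : Set (Space d)) : CompleteSpace (H01 Ω) :=
  (Submodule.isClosed_topologicalClosure (Submodule.span ℝ (testJets Ω))).completeSpace_coe

/-- The inclusion of `H_0^1(Ω)` into the space of pairs `(y, ∇y)`. -/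
def toJet (Ω : Set (Space d)) : H01 Ω →L[ℝ] Jet Ω :=
  (h01 Ω).subtypeL

/-- The divergence `∑ i, (∂ᵢ y)ᵢ` on the level of pairs. -/
def jetDivergence (Ω : Set (Space d)) : Jet Ω →L[ℝ] L2 Ω :=
  ∑ i : Fin d, ((EuclideanSpace.proj i : Space d →L[ℝ] ℝ).compLpL 2 (volume.restrict Ω)).comp
    ((PiLp.proj 2 (fun _ : Fin d => VecL2 Ω) i).comp
      (WithLp.sndL 2 ℝ (VecL2 Ω) (PiLp 2 (fun _ : Fin d => VecL2 Ω))))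

/-- The velocity field underlying an element of `H_0^1(Ω)`, as a map `H_0^1(Ω) → L^2(Ω)`. -/
def field (Ω : Set (Space d)) : H01 Ω →L[ℝ] VecL2 Ω :=
  (WithLp.fstL 2 ℝ (VecL2 Ω) (PiLp 2 (fun _ : Fin d => VecL2 Ω))).comp (toJet Ω)

/-- The gradient, as a map `H_0^1(Ω) → L^2(Ω)^d`. -/
def grad (Ω : Set (Space d)) : H01 Ω →L[ℝ] PiLp 2 (fun _ : Fin d => VecL2 Ω) :=
  (WithLp.sndL 2 ℝ (VecL2 Ω) (PiLp 2 (fun _ : Fin d => VecL2 Ω))).comp (toJet Ω)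

/-- The divergence, as a map `H_0^1(Ω) → L^2(Ω)`. -/
def divergence (Ω : Set (Space d)) : H01 Ω →L[ℝ] L2 Ω :=
  (jetDivergence Ω).comp (toJet Ω)

/-- The space `V(Ω)` of divergence free fields in `H_0^1(Ω)`. -/
def V (Ω : Set (Space d)) : Submodule ℝ (H01 Ω) :=
  (divergence Ω).ker

/-- The form `(∇y, ∇w) + (u y, w)`. -/
def form {Ω : Set (Space d)} (u : LInf Ω) (y w : H01 Ω) : ℝ :=
  ⟪grad Ω y, grad Ω w⟫ + ∫ x in Ω, u x * ⟪field Ω y x, field Ω w x⟫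

/-- `y` is a weak solution of `-Δy + u y + ∇p = F`, `div y = 0` in `Ω`, `y = 0` on `∂Ω`, in the
formulation where the pressure is eliminated by testing with divergence free fields. -/
def IsVelocity {Ω : Set (Space d)} (u : LInf Ω) (F : StrongDual ℝ (H01 Ω)) (y : H01 Ω) : Prop :=
  y ∈ V Ω ∧ ∀ w ∈ V Ω, form u y w = F w

/-- `(y, p)` is a solution of the mixed (saddle point) weak formulation of the same equations, with
pressure `p` and pressure test functions `q` in `L^2(Ω)` of mean value zero. -/
def IsVelocityPressure {Ω : Set (Space d)} (u : LInf Ω) (F : StrongDual ℝ (H01 Ω))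
    (y : H01 Ω) (p : L2 Ω) : Prop :=
  (∫ x in Ω, p x) = 0 ∧
  (∀ w : H01 Ω, form u y w - ⟪p, divergence Ω w⟫ = F w) ∧
  ∀ q : L2 Ω, (∫ x in Ω, q x) = 0 → ⟪q, divergence Ω y⟫ = 0

theorem jetDivergence_coe {Ω : Set (Space d)} (p : Jet Ω) :
    jetDivergence Ω p =ᵐ[volume.restrict Ω] fun x => ∑ i, p.snd i x i := by
  have h1 : jetDivergence Ω p = ∑ i, (EuclideanSpace.proj i : Space d →L[ℝ] ℝ).compLp (p.snd i) := by
    simp [jetDivergence]; rfl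
  rw [h1]
  have h2 : ∀ i, (EuclideanSpace.proj i : Space d →L[ℝ] ℝ).compLp (p.snd i)
      =ᵐ[volume.restrict Ω] fun x => p.snd i x i := fun i =>
    ContinuousLinearMap.coeFn_compLp _ _
  have h3 := Lp.coeFn_finsetSum (p := 2) (μ := volume.restrict Ω) Finset.univ
    (fun i => (EuclideanSpace.proj i : Space d →L[ℝ] ℝ).compLp (p.snd i))
  filter_upwards [h3, ae_all_iff.2 h2] with x hx hx2
  rw [hx]; simp [hx2]

theorem integral_divergence {Ω : Set (Space d)} (hΩb : Bornology.IsBounded Ω) (y : H01 Ω) :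
    ∫ x in Ω, divergence Ω y x = 0 := by
  have hfin : volume Ω ≠ (⊤ : ℝ≥0∞) := hΩb.measure_lt_top.ne
  have : IsFiniteMeasure (volume.restrict Ω) := ⟨by simpa using hΩb.measure_lt_top⟩
  let T : Jet Ω →L[ℝ] ℝ := (innerSL ℝ (indicatorConstLp 2 (μ := volume.restrict Ω)
    MeasurableSet.univ (by simpa using hfin) (1 : ℝ))).comp (jetDivergence Ω)
  have hT : ∀ p, T p = ∫ x in Ω, jetDivergence Ω p x := by
    intro p
    have := L2.inner_indicatorConstLp_one (𝕜 := ℝ) (μ := volume.restrict Ω)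
      (MeasurableSet.univ) (by simpa using hfin) (jetDivergence Ω p)
    simpa [T] using this
  have hle : h01 Ω ≤ T.ker := by
    refine Submodule.topologicalClosure_minimal _ (Submodule.span_le.2 ?_) T.isClosed_ker
    rintro p ⟨φ, ⟨h1, h2, h3⟩, -, h5⟩
    change T p = 0
    rw [hT, integral_congr_ae (jetDivergence_coe p),
      integral_congr_ae (g := fun x => ∑ i, fderiv ℝ φ x (EuclideanSpace.single i 1) i)
      (by filter_upwards [ae_all_iff.2 h5] with x hx; simp [hx])]
    rw [setIntegral_eq_integral_of_forall_compl_eq_zero]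
    · have hd1 : Differentiable ℝ φ := h1.differentiable (by simp)
      have hk : ∀ i : Fin d, Integrable
          (fun x => fderiv ℝ φ x (EuclideanSpace.single i 1) i) volume := by
        intro i
        refine Continuous.integrable_of_hasCompactSupport ?_ ?_
        · have := h1.continuous_fderiv (by simp)
          fun_prop
        · refine (h2.fderiv (𝕜 := ℝ)).comp_left
            (g := fun L : Space d →L[ℝ] Space d => L (EuclideanSpace.single i 1) i) (by simp)
      rw [integral_finsetSum _ fun i _ => hk i]
      refine Finset.sum_eq_zero fun i _ => ?_
      have hc : HasCompactSupport (fun x => φ x i) :=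
        h2.comp_left (g := fun z : Space d => z i) (by simp)
      have hphi : Differentiable ℝ (fun x => φ x i) := by fun_prop
      have key := integral_mul_fderiv_eq_neg_fderiv_mul_of_integrable (μ := (volume : Measure (Space d)))
        (f := fun _ => (1:ℝ)) (g := fun x => φ x i) (v := EuclideanSpace.single i 1)
        (by simp) (by
          have : ∀ x, fderiv ℝ (fun x => φ x i) x (EuclideanSpace.single i 1)
              = fderiv ℝ φ x (EuclideanSpace.single i 1) i := fun x => by
            have := ((EuclideanSpace.proj i : Space d →L[ℝ] ℝ).hasFDerivAt.comp x
              (hd1 x).hasFDerivAt).fderiv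
            exact congrArg (fun L => L (EuclideanSpace.single i 1)) this
          simpa [this] using hk i)
        (by simpa using (hphi.continuous).integrable_of_hasCompactSupport hc)
        (fun _ _ => by fun_prop) (fun x _ => hphi x)
      have this : ∀ x, fderiv ℝ (fun x => φ x i) x (EuclideanSpace.single i 1)
              = fderiv ℝ φ x (EuclideanSpace.single i 1) i := fun x => by
            have := ((EuclideanSpace.proj i : Space d →L[ℝ] ℝ).hasFDerivAt.comp x
              (hd1 x).hasFDerivAt).fderiv
            exact congrArg (fun L => L (EuclideanSpace.single i 1)) this
      simpa [this] using key
    · intro x hx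
      have : fderiv ℝ φ x = 0 := by
        have : x ∉ tsupport (fderiv ℝ φ) := fun h => hx (h3 (tsupport_fderiv_subset ℝ h))
        exact image_eq_zero_of_notMem_tsupport this
      simp [this]
  have := hle y.2
  have h' : T (toJet Ω y) = 0 := this
  rw [hT] at h'
  exact h'

/-- The velocity of a solution of the mixed formulation solves the formulation without pressure. -/
theorem IsVelocityPressure.isVelocity {Ω : Set (Space d)} (hΩb : Bornology.IsBounded Ω)
    {u : LInf Ω} {F : StrongDual ℝ (H01 Ω)} {y : H01 Ω} {p : L2 Ω}
    (h : IsVelocityPressure u F y p) : IsVelocity u F y := by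
  refine ⟨?_, fun w hw => ?_⟩
  · have := h.2.2 (divergence Ω y) (integral_divergence hΩb y)
    exact inner_self_eq_zero.1 this
  · have h0 : divergence Ω w = 0 := hw
    have := h.2.1 w
    rwa [h0, inner_zero_right, sub_zero] at this

/-- Multiplication of a field by `u`. -/
def mulL {Ω : Set (Space d)} (u : LInf Ω) : VecL2 Ω →L[ℝ] VecL2 Ω :=
  (ContinuousLinearMap.lsmul ℝ ℝ : ℝ →L[ℝ] Space d →L[ℝ] Space d).holderL (volume.restrict Ω) (⊤ : ℝ≥0∞) 2 2 u

theorem form_eq {Ω : Set (Space d)} (u : LInf Ω) (y w : H01 Ω) :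
    form u y w = ⟪grad Ω y, grad Ω w⟫ + ⟪mulL u (field Ω y), field Ω w⟫ := by
  unfold form
  congr 1
  rw [L2.inner_def]
  refine integral_congr_ae ?_
  filter_upwards [(ContinuousLinearMap.lsmul ℝ ℝ : ℝ →L[ℝ] Space d →L[ℝ] Space d).coeFn_holder
    (r := 2) u (field Ω y)] with x hx
  have : mulL u (field Ω y) x = u x • field Ω y x := hx
  rw [this, real_inner_smul_left]

/-- If the coefficient has a positive lower bound, then the velocity exists and is unique. -/
theorem existsUnique_velocity {Ω : Set (Space d)} (u : LInf Ω) {c : ℝ} (hc : 0 < c)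
    (hu : ∀ᵐ x ∂(volume.restrict Ω), c ≤ u x) (F : StrongDual ℝ (H01 Ω)) :
    ∃! y, IsVelocity u F y := by
  have : CompleteSpace (V Ω) := (divergence Ω).isClosed_ker.completeSpace_coe
  let G := (grad Ω).comp (V Ω).subtypeL
  let E := (field Ω).comp (V Ω).subtypeL
  let B : V Ω →L[ℝ] V Ω →L[ℝ] ℝ := (innerSL ℝ).bilinearComp G G +
    (innerSL ℝ).bilinearComp ((mulL u).comp E) E
  have hB : ∀ y w : V Ω, B y w = form u y w := fun y w => (form_eq u y w).symm
  have hco : IsCoercive B := by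
    refine ⟨min 1 c, lt_min one_pos hc, fun y => ?_⟩
    rw [hB]
    have h1 : ‖y‖ * ‖y‖ = ‖field Ω y‖^2 + ‖grad Ω y‖^2 := by
      have := WithLp.prod_norm_sq_eq_of_L2 (toJet Ω y)
      rw [← sq]; exact this
    have h2 : c * ‖field Ω y‖^2 ≤ ∫ x in Ω, u x * ⟪field Ω y x, field Ω y x⟫ := by
      rw [← real_inner_self_eq_norm_sq, L2.inner_def, ← integral_const_mul]
      refine integral_mono_ae ((L2.integrable_inner _ _).const_mul c) ?_ ?_
      · have := L2.integrable_inner (𝕜 := ℝ) (mulL u (field Ω y)) (field Ω y)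
        refine this.congr ?_
        filter_upwards [(ContinuousLinearMap.lsmul ℝ ℝ : ℝ →L[ℝ] Space d →L[ℝ] Space d).coeFn_holder
          (r := 2) u (field Ω y)] with x hx
        have : mulL u (field Ω y) x = u x • field Ω y x := hx
        rw [this, real_inner_smul_left]
      · filter_upwards [hu] with x hx
        exact mul_le_mul_of_nonneg_right hx real_inner_self_nonneg
    unfold form
    rw [mul_assoc, h1, real_inner_self_eq_norm_sq]
    nlinarith [min_le_left 1 c, min_le_right 1 c, sq_nonneg ‖field Ω y‖, sq_nonneg ‖grad Ω y‖]
  let A := hco.continuousLinearEquivOfBilin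
  let g : V Ω := (InnerProductSpace.toDual ℝ (V Ω)).symm (F.comp (V Ω).subtypeL)
  have hg : ∀ w : V Ω, ⟪g, w⟫ = F w := fun w => by simp [g]
  refine ⟨A.symm g, ⟨(A.symm g).2, fun w hw => ?_⟩, fun y hy => ?_⟩
  · have := hco.continuousLinearEquivOfBilin_apply (A.symm g) ⟨w, hw⟩
    rw [hB] at this
    rw [← this, ← hg ⟨w, hw⟩]
    simp [A]
  · have : g = A ⟨y, hy.1⟩ := hco.unique_continuousLinearEquivOfBilin fun w => by
      rw [hB, hg]; exact (hy.2 w w.2).symm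
    rw [this]; simp

open Classical in
/-- The solution operator `F ↦ y` of the equations with coefficient `u`. (It is only used for
coefficients with a positive lower bound, for which `y` exists and is unique.) -/
def velocity {Ω : Set (Space d)} (u : LInf Ω) (F : StrongDual ℝ (H01 Ω)) : H01 Ω :=
  if h : ∃ y, IsVelocity u F y then h.choose else 0

theorem isVelocity_velocity {Ω : Set (Space d)} (u : LInf Ω) {c : ℝ} (hc : 0 < c)
    (hu : ∀ᵐ x ∂(volume.restrict Ω), c ≤ u x) (F : StrongDual ℝ (H01 Ω)) :
    IsVelocity u F (velocity u F) := by
  have h := (existsUnique_velocity u hc hu F).exists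
  rw [velocity, dif_pos h]
  exact h.choose_spec

/-- If `(y, p)` solves the mixed formulation, then `y` is the value of the solution operator. -/
theorem IsVelocityPressure.velocity_eq {Ω : Set (Space d)} (hΩb : Bornology.IsBounded Ω)
    {u : LInf Ω} {c : ℝ} (hc : 0 < c) (hu : ∀ᵐ x ∂(volume.restrict Ω), c ≤ u x)
    {F : StrongDual ℝ (H01 Ω)} {y : H01 Ω} {p : L2 Ω} (h : IsVelocityPressure u F y p) :
    velocity u F = y :=
  (existsUnique_velocity u hc hu F).unique (isVelocity_velocity u hc hu F) (h.isVelocity hΩb)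

/-- The functional `w ↦ (g, w)` on `H_0^1(Ω)` given by a square integrable field `g`. -/
def ofField {Ω : Set (Space d)} (g : VecL2 Ω) : StrongDual ℝ (H01 Ω) :=
  (innerSL ℝ g).comp (field Ω)

/-- The adjoint state `z` of a control `u`, which solves the equations with the right-hand side
`y - yΩ`, where `y` is the velocity associated with `u` and `yΩ` the desired velocity. -/
def adjointState {Ω : Set (Space d)} (f : StrongDual ℝ (H01 Ω)) (yΩ : VecL2 Ω) (u : LInf Ω) :
    H01 Ω :=
  velocity u (ofField (field Ω (velocity u f) - yΩ))

/-- The cost functional `J(y, u)`. -/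
def cost {Ω : Set (Space d)} (α : ℝ) (yΩ : VecL2 Ω) (y : H01 Ω) (u : LInf Ω) : ℝ :=
  1 / 2 * ‖field Ω y - yΩ‖ ^ 2 + α / 2 * ∫ x in Ω, u x ^ 2

/-- The reduced cost functional `j(u) = J(y, u)` with `y` the velocity associated with `u`. -/
def reducedCost {Ω : Set (Space d)} (α : ℝ) (f : StrongDual ℝ (H01 Ω)) (yΩ : VecL2 Ω)
    (u : LInf Ω) : ℝ :=
  cost α yΩ (velocity u f) u

/-- The set of admissible controls. (A measurable function with `a ≤ u ≤ b` almost everywhere is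
essentially bounded.) -/
def admissible (Ω : Set (Space d)) (a b : ℝ) : Set (LInf Ω) :=
  {u | ∀ᵐ x ∂(volume.restrict Ω), a ≤ u x ∧ u x ≤ b}

/-- `ubar` is admissible and is locally optimal in the sense of `L^2(Ω)`. -/
def IsLocallyOptimal {Ω : Set (Space d)} (a b α : ℝ) (f : StrongDual ℝ (H01 Ω)) (yΩ : VecL2 Ω)
    (ubar : LInf Ω) : Prop :=
  ubar ∈ admissible Ω a b ∧ ∃ δ : ℝ, 0 < δ ∧ ∀ u ∈ admissible Ω a b,
    eLpNorm (⇑(u - ubar)) 2 (volume.restrict Ω) ≤ ENNReal.ofReal δ →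
      cost α yΩ (velocity ubar f) ubar ≤ cost α yΩ (velocity u f) u

/-- The cone of critical directions. -/
def criticalCone {Ω : Set (Space d)} (a b α : ℝ) (f : StrongDual ℝ (H01 Ω)) (yΩ : VecL2 Ω)
    (ubar : LInf Ω) : Set (L2 Ω) :=
  {v | ∀ᵐ x ∂(volume.restrict Ω),
    (ubar x = a → 0 ≤ v x) ∧ (ubar x = b → v x ≤ 0) ∧
    (α * ubar x - ⟪field Ω (velocity ubar f) x, field Ω (adjointState f yΩ ubar) x⟫ ≠ 0 →
      v x = 0)}

/-- `B` is a continuous bilinear form on `L^2(Ω)` that agrees with the second Fréchet derivative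
`j''(u)` of the functional `j` on `L^∞(Ω)` for directions in `L^2(Ω) ∩ L^∞(Ω)`. -/
def ExtendsSecondDeriv {Ω : Set (Space d)} (j : LInf Ω → ℝ) (u : LInf Ω)
    (B : L2 Ω →L[ℝ] L2 Ω →L[ℝ] ℝ) : Prop :=
  ∀ (v w : L2 Ω) (hv : MemLp v ∞ (volume.restrict Ω)) (hw : MemLp w ∞ (volume.restrict Ω)),
    B v w = fderiv ℝ (fderiv ℝ j) u (hv.toLp v) (hw.toLp w)

end Brinkman

end

noncomputable section

namespace Brinkman

open scoped NNReal

variable {d : ℕ}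

/-! For `d ≤ 3` the space `H_0^1` embeds into `L^4`, so `(v y, w)` is a bounded trilinear form for
`v` merely in `L^2` (`exists_trilinear`). The state operator is therefore a continuous affine
function of the coefficient in the `L^2` norm. At `ubar` it is invertible by Lax–Milgram; invertible
operators form an open set on which inversion is smooth. Hence `j` is, near `ubar`, the restriction
to `L^∞` of a functional `J` of class `C^2` at `ubar` in the `L^2` topology
(`exists_extension_reducedCost`). The form `J''(ubar)` is the required extension of `j''(ubar)`, and
density of `L^∞` in `L^2` makes it unique.

The adjoint state gives `J'(ubar) v = ∫ (α ubar - y·z) v`, which vanishes on the critical cone. If a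
critical direction `w` is bounded and `ubar + t w` is admissible for small `t > 0`, a one-variable
argument gives `J''(ubar) w² ≥ 0` (`fderiv_fderiv_nonneg_of_eventually_le`). A general critical `v`
need not be feasible. It is set to zero where it is large or where `ubar` is close to a bound
without attaining it. These truncations are critical, feasible and converge to `v` in `L^2`
(`exists_seq_criticalCone`), so continuity of `J''(ubar)` on `L^2` concludes. -/

/-! ### Sobolev embedding into `L^4` -/

instance fact_one_le_four : Fact ((1 : ℝ≥0∞) ≤ 4) := ⟨by norm_num⟩

instance holderTriple_four_four_two : ENNReal.HolderTriple 4 4 2 := by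
  constructor
  have h : (4 : ℝ≥0∞) = 2 * 2 := by norm_num
  rw [h, ENNReal.mul_inv (by simp) (by simp), ← two_mul, ← mul_assoc,
    ENNReal.mul_inv_cancel (by simp) (by simp), one_mul]

/-- The norm of a linear map on `ℝ^d` is at most the sum of the norms of its values at the unit
vectors. -/
theorem norm_le_sum_single (T : Space d →L[ℝ] Space d) :
    ‖T‖ ≤ ∑ i, ‖T (EuclideanSpace.single i 1)‖ := by
  refine T.opNorm_le_bound (by positivity) fun x => ?_
  have hx : x = ∑ i, x i • (EuclideanSpace.single i (1 : ℝ) : Space d) := by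
    ext j
    simp [Finset.sum_apply, Pi.single_apply]
  calc ‖T x‖ = ‖∑ i, x i • T (EuclideanSpace.single i 1)‖ := by
        conv_lhs => rw [hx]
        simp [map_sum]
    _ ≤ ∑ i, ‖x i • T (EuclideanSpace.single i 1)‖ := norm_sum_le _ _
    _ ≤ ∑ i, ‖T (EuclideanSpace.single i 1)‖ * ‖x‖ := by
        refine Finset.sum_le_sum fun i _ => ?_
        rw [norm_smul, mul_comm]
        gcongr
        exact PiLp.norm_apply_le x i
    _ = _ := by rw [Finset.sum_mul]

/-- The Sobolev inequality `‖φ‖_{L^4} ≤ C ‖(φ, ∇φ)‖` for test fields. -/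
theorem exists_eLpNorm_four_le_of_mem_testJets (hd : d = 2 ∨ d = 3) {Ω : Set (Space d)}
    (hΩb : Bornology.IsBounded Ω) :
    ∃ C : ℝ≥0, ∀ p ∈ testJets Ω, eLpNorm p.fst 4 (volume.restrict Ω) ≤ C * ‖p‖ₑ := by
  have hfin : IsFiniteMeasure (volume.restrict Ω) := ⟨by simpa using hΩb.measure_lt_top⟩
  set M : ℝ≥0∞ := (volume.restrict Ω) univ ^ (1 / ((12 / 7 : ℝ≥0) : ℝ≥0∞).toReal
    - 1 / (2 : ℝ≥0∞).toReal)
  have hM : M ≠ ⊤ := ENNReal.rpow_ne_top_of_nonneg (by norm_num) (measure_ne_top _ _)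
  set K : ℝ≥0 := eLpNormLESNormFDerivOfLeConst (Space d) (volume : Measure (Space d)) Ω
    (12 / 7 : ℝ≥0) (4 : ℝ≥0)
  refine ⟨K * (d * M.toNNReal), ?_⟩
  rintro p ⟨φ, ⟨h1, h2, h3⟩, h4, h5⟩
  have hc : Continuous (fderiv ℝ φ) := h1.continuous_fderiv (by simp)
  have hsup : Function.support (fderiv ℝ φ) ⊆ Ω :=
    (subset_tsupport _).trans ((tsupport_fderiv_subset ℝ).trans h3)
  have hfr : Module.finrank ℝ (Space d) = d := by simp
  -- The exponent `p = 12/7` serves both dimensions: `p < d`, and `1/p - 1/d ≤ 1/4` with equality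
  -- for `d = 3`. The exponent 2 would violate `p < d` in the plane. Since `p ≤ 2` and `Ω` has
  -- finite measure, Hölder's inequality returns to the `L^2` norm at the cost of the factor `M`.
  have hS := eLpNorm_le_eLpNorm_fderiv_of_le (volume : Measure (Space d)) (u := φ) (s := Ω)
    (h1.of_le (by norm_num)) ((subset_tsupport _).trans h3) (p := 12 / 7) (q := 4)
    (by rw [one_le_div] <;> norm_num)
    (by rw [hfr]; rw [← NNReal.coe_lt_coe]; rcases hd with rfl | rfl <;> norm_num)
    (by rw [hfr]; rcases hd with rfl | rfl <;> norm_num) hΩb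
  have hP : eLpNorm (fderiv ℝ φ) 2 (volume.restrict Ω) ≤ d * ‖p‖ₑ := by
    calc eLpNorm (fderiv ℝ φ) 2 (volume.restrict Ω)
        ≤ eLpNorm (∑ i, fun x => ‖fderiv ℝ φ x (EuclideanSpace.single i 1)‖) 2
          (volume.restrict Ω) := by
          refine eLpNorm_mono_real fun x => ?_
          simpa using norm_le_sum_single (fderiv ℝ φ x)
      _ ≤ ∑ i : Fin d, eLpNorm (fun x => ‖fderiv ℝ φ x (EuclideanSpace.single i 1)‖) 2
          (volume.restrict Ω) := by
          refine eLpNorm_sum_le (fun i _ => ?_) (by norm_num)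
          exact Continuous.aestronglyMeasurable (by fun_prop)
      _ ≤ ∑ i : Fin d, ‖p‖ₑ := by
          refine Finset.sum_le_sum fun i _ => ?_
          rw [eLpNorm_norm, ← eLpNorm_congr_ae (h5 i), ← Lp.enorm_def, enorm_le_iff_norm_le]
          exact (PiLp.norm_apply_le p.snd i).trans (WithLp.norm_snd_le _ p)
      _ = d * ‖p‖ₑ := by simp
  calc eLpNorm p.fst 4 (volume.restrict Ω) = eLpNorm φ 4 (volume.restrict Ω) :=
        eLpNorm_congr_ae h4
    _ ≤ eLpNorm φ 4 volume := eLpNorm_restrict_le _ _ _ _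
    _ ≤ K * eLpNorm (fderiv ℝ φ) ((12 / 7 : ℝ≥0) : ℝ≥0∞) volume := by exact_mod_cast hS
    _ = K * eLpNorm (fderiv ℝ φ) ((12 / 7 : ℝ≥0) : ℝ≥0∞) (volume.restrict Ω) :=
        congrArg (_ * ·) (eLpNorm_restrict_eq_of_support_subset (ε := Space d →L[ℝ] Space d)
          hsup).symm
    _ ≤ K * (eLpNorm (fderiv ℝ φ) 2 (volume.restrict Ω) * M) := by
        gcongr
        refine eLpNorm_le_eLpNorm_mul_rpow_measure_univ ?_ hc.aestronglyMeasurable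
        have : (12 / 7 : ℝ≥0) ≤ 2 := by rw [div_le_iff₀] <;> norm_num
        exact_mod_cast this
    _ ≤ K * (d * ‖p‖ₑ * M) := by gcongr
    _ = _ := by
        push_cast [ENNReal.coe_toNNReal hM]
        ring

/-- Test jets are stable under linear combinations, so elements of `H_0^1` are limits of test jets
themselves and estimates for these pass to the limit. -/
theorem span_testJets (Ω : Set (Space d)) : (Submodule.span ℝ (testJets Ω) : Set (Jet Ω)) =
    testJets Ω := by
  let S : Submodule ℝ (Jet Ω) :=
    { carrier := testJets Ω
      zero_mem' := by
        refine ⟨0, ⟨contDiff_const, HasCompactSupport.zero, by simp⟩, ?_, fun i => ?_⟩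
        · exact Lp.coeFn_zero _ _ _
        · filter_upwards [Lp.coeFn_zero (Space d) 2 (volume.restrict Ω)] with x hx
          simpa using hx
      add_mem' := by
        rintro p q ⟨φ, ⟨h1, h2, h3⟩, h4, h5⟩ ⟨ψ, ⟨k1, k2, k3⟩, k4, k5⟩
        refine ⟨φ + ψ, ⟨h1.add k1, h2.add k2, (tsupport_add φ ψ).trans (union_subset h3 k3)⟩,
          ?_, fun i => ?_⟩
        · exact (Lp.coeFn_add p.fst q.fst).trans (h4.add k4)
        · filter_upwards [Lp.coeFn_add (p.snd i) (q.snd i), h5 i, k5 i] with x hx hx1 hx2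
          have e : fderiv ℝ (φ + ψ) x = fderiv ℝ φ x + fderiv ℝ ψ x :=
            fderiv_add (h1.differentiable (by simp) x) (k1.differentiable (by simp) x)
          rw [e, add_apply, ← hx1, ← hx2]
          exact hx
      smul_mem' := by
        rintro c p ⟨φ, ⟨h1, h2, h3⟩, h4, h5⟩
        refine ⟨c • φ, ⟨h1.const_smul c, h2.smul_left (f := fun _ => c),
          (tsupport_smul_subset_right (fun _ => c) φ).trans h3⟩, ?_, fun i => ?_⟩
        · exact (Lp.coeFn_smul c p.fst).trans (h4.const_smul c)
        · filter_upwards [Lp.coeFn_smul c (p.snd i), h5 i] with x hx hx1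
          have e : fderiv ℝ (c • φ) x = c • fderiv ℝ φ x :=
            fderiv_const_smul (h1.differentiable (by simp) x) c
          rw [e, smul_apply, ← hx1]
          exact hx }
  exact congrArg SetLike.coe (Submodule.span_eq S)

/-- The Sobolev inequality `‖y‖_{L^4} ≤ C ‖y‖_{H^1}` on `H_0^1(Ω)`. -/
theorem exists_eLpNorm_four_le (hd : d = 2 ∨ d = 3) {Ω : Set (Space d)}
    (hΩb : Bornology.IsBounded Ω) :
    ∃ C : ℝ≥0, ∀ y : H01 Ω, eLpNorm (field Ω y) 4 (volume.restrict Ω) ≤ C * ‖y‖ₑ := by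
  obtain ⟨C, hC⟩ := exists_eLpNorm_four_le_of_mem_testJets hd hΩb
  refine ⟨C, fun y => ?_⟩
  have hy : toJet Ω y ∈ closure (testJets Ω) := by
    rw [← span_testJets]
    exact y.2
  obtain ⟨p, hp, hlim⟩ := mem_closure_iff_seq_limit.1 hy
  have hlim1 : Tendsto (fun n => (p n).fst) atTop (𝓝 (field Ω y)) :=
    ((WithLp.fstL 2 ℝ (VecL2 Ω) (PiLp 2 (fun _ : Fin d => VecL2 Ω))).continuous.tendsto _).comp hlim
  -- Membership of the limit in `L^4` is not yet known. Fatou's lemma along an almost everywhere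
  -- convergent subsequence gives it together with the bound.
  obtain ⟨ns, hns, hae⟩ := (tendstoInMeasure_of_tendsto_Lp hlim1).exists_seq_tendsto_ae
  refine (Lp.eLpNorm_lim_le_liminf_eLpNorm (fun n => Lp.aestronglyMeasurable (p (ns n)).fst) _
    hae).trans ?_
  have hlim2 : Tendsto (fun n => C * ‖p (ns n)‖ₑ) atTop (𝓝 (C * ‖toJet Ω y‖ₑ)) :=
    ENNReal.Tendsto.const_mul ((hlim.comp hns.tendsto_atTop).enorm) (Or.inr (by simp))
  calc _ ≤ liminf (fun n => C * ‖p (ns n)‖ₑ) atTop := liminf_le_liminf (.of_forall fun n => hC _ (hp _))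
    _ = C * ‖toJet Ω y‖ₑ := hlim2.liminf_eq
    _ = C * ‖y‖ₑ := rfl

/-- The Sobolev embedding of `H_0^1(Ω)` into `L^4(Ω)`. -/
theorem exists_embedding_four (hd : d = 2 ∨ d = 3) {Ω : Set (Space d)}
    (hΩb : Bornology.IsBounded Ω) :
    ∃ E : H01 Ω →L[ℝ] Lp (Space d) 4 (volume.restrict Ω),
      ∀ y, E y =ᵐ[volume.restrict Ω] field Ω y := by
  obtain ⟨C, hC⟩ := exists_eLpNorm_four_le hd hΩb
  have hm : ∀ y : H01 Ω, MemLp (field Ω y) 4 (volume.restrict Ω) := fun y =>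
    ⟨Lp.aestronglyMeasurable _, (hC y).trans_lt (ENNReal.mul_lt_top (by simp) (by simp))⟩
  let E : H01 Ω →ₗ[ℝ] Lp (Space d) 4 (volume.restrict Ω) :=
    { toFun := fun y => (hm y).toLp
      map_add' := fun y w => by
        rw [← MemLp.toLp_add]
        refine MemLp.toLp_congr _ _ ?_
        rw [map_add]
        exact Lp.coeFn_add _ _
      map_smul' := fun c y => by
        rw [RingHom.id_apply, ← MemLp.toLp_const_smul]
        refine MemLp.toLp_congr _ _ ?_
        rw [map_smul]
        exact Lp.coeFn_smul _ _ }
  refine ⟨E.mkContinuous C fun y => ?_, fun y => (hm y).coeFn_toLp⟩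
  have h := hC y
  rw [← eLpNorm_congr_ae (hm y).coeFn_toLp] at h
  have h' := ENNReal.toReal_mono (ENNReal.mul_ne_top (by simp) (by simp)) h
  rw [ENNReal.toReal_mul, ENNReal.coe_toReal, toReal_enorm] at h'
  exact h'

/-! ### Second derivatives: one-sided minimality and linear substitution -/

/-- The second-order necessary condition along a direction in which the first derivative
vanishes. -/
theorem fderiv_fderiv_nonneg_of_eventually_le {E : Type*} [NormedAddCommGroup E] [NormedSpace ℝ E]
    {J : E → ℝ} {u v : E} (hJ : ContDiffAt ℝ 2 J u) (h1 : fderiv ℝ J u v = 0)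
    (hmin : ∀ᶠ t in 𝓝[>] (0 : ℝ), J u ≤ J (u + t • v)) :
    0 ≤ fderiv ℝ (fderiv ℝ J) u v v := by
  by_contra! hneg
  have hu : u + (0 : ℝ) • v = u := by simp
  have hline : ∀ t : ℝ, HasDerivAt (fun t : ℝ => u + t • v) v t := fun t => by
    simpa using ((hasDerivAt_id t).smul_const v).const_add u
  have hcont : Tendsto (fun t : ℝ => u + t • v) (𝓝 0) (𝓝 u) := by
    simpa using (hline 0).continuousAt.tendsto
  have hD : HasFDerivAt (fderiv ℝ J) (fderiv ℝ (fderiv ℝ J) u) (u + (0 : ℝ) • v) := by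
    rw [hu]
    exact ((hJ.fderiv_right (m := 1) (by norm_num)).differentiableAt (by norm_num)).hasFDerivAt
  have hg : HasDerivAt (fun t : ℝ => fderiv ℝ J (u + t • v) v) (fderiv ℝ (fderiv ℝ J) u v v) 0 :=
    (ContinuousLinearMap.apply ℝ ℝ v).hasFDerivAt.comp_hasDerivAt (0 : ℝ)
      (hD.comp_hasDerivAt (0 : ℝ) (hline 0))
  -- The function `t ↦ J'(u + t v) v` vanishes at 0 and has negative derivative there, so it is
  -- negative for small `t > 0`.
  have hsl := (hasDerivAt_iff_tendsto_slope.1 hg).eventually (eventually_lt_nhds hneg)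
  have hdiff : ∀ᶠ t in 𝓝 (0 : ℝ), DifferentiableAt ℝ J (u + t • v) :=
    hcont.eventually ((hJ.eventually (by simp)).mono fun x hx => hx.differentiableAt (by norm_num))
  have hsl' : ∀ᶠ t in 𝓝[>] (0 : ℝ), fderiv ℝ J (u + t • v) v < 0 := by
    filter_upwards [hsl.filter_mono (nhdsWithin_mono 0 fun t (ht : 0 < t) => ht.ne'),
      self_mem_nhdsWithin] with t ht ht0
    rw [slope_def_field] at ht
    simp only [hu, h1, sub_zero] at ht
    exact (div_neg_iff.1 ht).elim (fun h => absurd h.2 (not_lt.2 (le_of_lt ht0))) fun h => h.1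
  obtain ⟨ε, hε, hε'⟩ := mem_nhdsGT_iff_exists_Ioo_subset.1
    (hsl'.and (hmin.and (hdiff.filter_mono nhdsWithin_le_nhds)))
  have hε0 : (0 : ℝ) < ε := hε
  have hderiv : ∀ t ∈ Ioo 0 ε, HasDerivAt (fun t : ℝ => J (u + t • v))
      (fderiv ℝ J (u + t • v) v) t := fun t ht =>
    ((hε' ht).2.2.hasFDerivAt).comp_hasDerivAt t (hline t)
  have hmem : ∀ t ∈ Ioc 0 (ε / 2), t ∈ Ioo 0 ε := fun t ht => ⟨ht.1, by linarith [ht.2]⟩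
  -- By the mean value theorem `J` would be smaller at `ε / 2` than at 0. Halving keeps the endpoint
  -- inside the interval where all the local facts hold.
  obtain ⟨s, hs, hs'⟩ := exists_hasDerivAt_eq_slope (fun t : ℝ => J (u + t • v))
    (fun t => fderiv ℝ J (u + t • v) v) (half_pos hε0)
    (fun t ht => by
      rcases ht.1.eq_or_lt with rfl | h
      · have := (hdiff.self_of_nhds.hasFDerivAt.comp_hasDerivAt (0 : ℝ) (hline 0)).continuousAt
        exact this.continuousWithinAt
      · exact (hderiv t (hmem t ⟨h, ht.2⟩)).continuousAt.continuousWithinAt)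
    fun t ht => hderiv t (hmem t ⟨ht.1, ht.2.le⟩)
  have h2 := (hε' (hmem (ε / 2) ⟨half_pos hε0, le_rfl⟩)).2.1
  have h3 := (hε' (hmem s ⟨hs.1, hs.2.le⟩)).1
  simp only [hu, sub_zero] at hs'
  rw [hs'] at h3
  exact absurd h3 (not_lt.2 (div_nonneg (sub_nonneg.2 h2) (half_pos hε0).le))

/-- The second derivative of the composition with a continuous linear map. -/
theorem fderiv_fderiv_comp_clm {E F : Type*} [NormedAddCommGroup E] [NormedSpace ℝ E]
    [NormedAddCommGroup F] [NormedSpace ℝ F] {J : F → ℝ} {j : E → ℝ} {L : E →L[ℝ] F} {u : E}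
    (hJ : ContDiffAt ℝ 2 J (L u)) (hj : ∀ᶠ x in 𝓝 u, j x = J (L x)) (v w : E) :
    fderiv ℝ (fderiv ℝ j) u v w = fderiv ℝ (fderiv ℝ J) (L u) (L v) (L w) := by
  have h1 : fderiv ℝ j =ᶠ[𝓝 u] fun x => (fderiv ℝ J (L x)).comp L := by
    filter_upwards [hj.eventually_nhds,
      L.continuous.continuousAt.eventually (hJ.eventually (by simp))] with x hx hx2
    rw [EventuallyEq.fderiv_eq (f₁ := j) (f := J ∘ L) hx]
    exact ((hx2.differentiableAt (by norm_num)).hasFDerivAt.comp x L.hasFDerivAt).fderiv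
  have hD : HasFDerivAt (fderiv ℝ J) (fderiv ℝ (fderiv ℝ J) (L u)) (L u) :=
    ((hJ.fderiv_right (m := 1) (by norm_num)).differentiableAt (by norm_num)).hasFDerivAt
  have h2 := (((ContinuousLinearMap.compL ℝ E F ℝ).flip L).hasFDerivAt.comp u
    (hD.comp u L.hasFDerivAt)).fderiv
  rw [h1.fderiv_eq]
  exact congrArg (fun T => T v w) h2

/-! ### Approximation in `L^2` and the embedding of `L^∞` -/

/-- The restriction of a square integrable function to sets that exhaust `Ω` converges. -/
theorem exists_seq_tendsto_indicator {Ω : Set (Space d)} (v : L2 Ω) {s : ℕ → Set (Space d)}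
    (hs : ∀ k, NullMeasurableSet (s k) (volume.restrict Ω))
    (hae : ∀ᵐ x ∂(volume.restrict Ω), ∀ᶠ k in atTop, x ∈ s k) :
    ∃ vk : ℕ → L2 Ω, Tendsto vk atTop (𝓝 v) ∧
      ∀ k, vk k =ᵐ[volume.restrict Ω] (s k).indicator v := by
  have hm : ∀ k, MemLp ((s k).indicator v) 2 (volume.restrict Ω) := fun k =>
    (Lp.memLp v).mono ((Lp.aestronglyMeasurable v).indicator₀ (hs k))
      (.of_forall fun x => norm_indicator_le_norm_self _ _)
  refine ⟨fun k => (hm k).toLp, ?_, fun k => (hm k).coeFn_toLp⟩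
  rw [tendsto_iff_norm_sub_tendsto_zero]
  have key : Tendsto (fun k => ‖(hm k).toLp - v‖ ^ 2) atTop (𝓝 0) := by
    have hint : ∀ k, ‖(hm k).toLp - v‖ ^ 2
        = ∫ x in Ω, ((s k).indicator v x - v x) * ((s k).indicator v x - v x) := by
      intro k
      rw [← real_inner_self_eq_norm_sq, L2.inner_def]
      refine integral_congr_ae ?_
      filter_upwards [Lp.coeFn_sub (hm k).toLp v, (hm k).coeFn_toLp] with x hx hx2
      rw [hx, Pi.sub_apply, hx2]
      rfl
    simp only [hint]
    have hv : Integrable (fun x => v x * v x) (volume.restrict Ω) :=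
      L2.integrable_inner (𝕜 := ℝ) v v
    have h0 : (0 : ℝ) = ∫ x in Ω, (0 : ℝ) := by simp
    rw [h0]
    refine tendsto_integral_of_dominated_convergence (fun x => v x * v x) (fun k => ?_) hv
      (fun k => .of_forall fun x => ?_) ?_
    · have := (hm k).aestronglyMeasurable.sub (Lp.aestronglyMeasurable v)
      exact this.mul this
    · by_cases hx : x ∈ s k
      · simpa [hx] using mul_self_nonneg (v x)
      · simp [hx]
    · filter_upwards [hae] with x hx
      refine tendsto_const_nhds.congr' ?_
      filter_upwards [hx] with k hk
      simp [hk]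
  simpa using key.sqrt

/-- The embedding of `L^∞(Ω)` into `L^2(Ω)`. -/
def toL2 (Ω : Set (Space d)) [IsFiniteMeasure (volume.restrict Ω)] : LInf Ω →L[ℝ] L2 Ω :=
  ((ContinuousLinearMap.mul ℝ ℝ).holderL (volume.restrict Ω) ∞ 2 2).flip
    (indicatorConstLp 2 MeasurableSet.univ (measure_ne_top _ _) (1 : ℝ))

theorem coeFn_toL2 {Ω : Set (Space d)} [IsFiniteMeasure (volume.restrict Ω)] (u : LInf Ω) :
    toL2 Ω u =ᵐ[volume.restrict Ω] u := by
  filter_upwards [(ContinuousLinearMap.mul ℝ ℝ).coeFn_holder (r := 2) u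
    (indicatorConstLp 2 (μ := volume.restrict Ω) MeasurableSet.univ (measure_ne_top _ _) (1 : ℝ)),
    indicatorConstLp_coeFn (p := 2) (μ := volume.restrict Ω) (hs := MeasurableSet.univ)
      (hμs := measure_ne_top _ _) (c := (1 : ℝ))] with x hx hx2
  refine Eq.trans hx ?_
  rw [hx2]
  simp

theorem toL2_toLp {Ω : Set (Space d)} [IsFiniteMeasure (volume.restrict Ω)] {v : Space d → ℝ}
    {w : L2 Ω} (hv : MemLp v ∞ (volume.restrict Ω)) (h : w =ᵐ[volume.restrict Ω] v) :
    toL2 Ω hv.toLp = w :=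
  Lp.ext ((coeFn_toL2 _).trans (hv.coeFn_toLp.trans h.symm))

/-- The range of `toL2` is exactly `L^2 ∩ L^∞`, which trades bounded representatives for elements of
`L^∞`. -/
theorem extendsSecondDeriv_iff {Ω : Set (Space d)} [IsFiniteMeasure (volume.restrict Ω)]
    {j : LInf Ω → ℝ} {u : LInf Ω} {B : L2 Ω →L[ℝ] L2 Ω →L[ℝ] ℝ} :
    ExtendsSecondDeriv j u B ↔
      ∀ v w : LInf Ω, B (toL2 Ω v) (toL2 Ω w) = fderiv ℝ (fderiv ℝ j) u v w := by
  refine ⟨fun h v w => ?_, fun h v w hv hw => ?_⟩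
  · have hm : ∀ v : LInf Ω, MemLp (toL2 Ω v) ∞ (volume.restrict Ω) := fun v =>
      (memLp_congr_ae (coeFn_toL2 v)).2 (Lp.memLp v)
    have e : ∀ v : LInf Ω, (hm v).toLp = v := fun v =>
      Lp.ext ((hm v).coeFn_toLp.trans (coeFn_toL2 v))
    rw [h _ _ (hm v) (hm w), e, e]
  · rw [← h, toL2_toLp hv .rfl, toL2_toLp hw .rfl]

/-- Setting `v` to zero where `|v| > k` gives bounded functions converging to `v`. Density is what
makes the extension of `j''` unique. -/
theorem denseRange_toL2 (Ω : Set (Space d)) [IsFiniteMeasure (volume.restrict Ω)] :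
    DenseRange (toL2 Ω) := by
  intro v
  obtain ⟨vk, hlim, hvk⟩ := exists_seq_tendsto_indicator v (s := fun k => {x | |v x| ≤ k})
    (fun k => by
      have := (Lp.aestronglyMeasurable v).aemeasurable
      exact nullMeasurableSet_le this.abs aemeasurable_const)
    (.of_forall fun x => by
      obtain ⟨n, hn⟩ := exists_nat_ge |v x|
      filter_upwards [eventually_ge_atTop n] with k hk
      exact hn.trans (by exact_mod_cast hk))
  refine mem_closure_of_tendsto hlim (.of_forall fun k => ?_)
  have hm : MemLp (vk k) ∞ (volume.restrict Ω) := by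
    refine memLp_top_of_bound (Lp.aestronglyMeasurable _) k ?_
    filter_upwards [hvk k] with x hx
    rw [hx, indicator_apply]
    split_ifs with h
    · exact h
    · simp
  exact ⟨hm.toLp, toL2_toLp hm .rfl⟩

/-! ### The state operator with `L^2` coefficients -/

/-- The Hilbert space of divergence free fields in `H_0^1(Ω)`. -/
def VSpace (Ω : Set (Space d)) : Type := V Ω

instance (Ω : Set (Space d)) : NormedAddCommGroup (VSpace Ω) :=
  inferInstanceAs (NormedAddCommGroup (V Ω))

instance (Ω : Set (Space d)) : InnerProductSpace ℝ (VSpace Ω) :=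
  inferInstanceAs (InnerProductSpace ℝ (V Ω))

instance (Ω : Set (Space d)) : CompleteSpace (VSpace Ω) :=
  (divergence Ω).isClosed_ker.completeSpace_coe

/-- The inclusion of the divergence free fields into `H_0^1(Ω)`. -/
def incl (Ω : Set (Space d)) : VSpace Ω →L[ℝ] H01 Ω :=
  (V Ω).subtypeL

theorem incl_mem {Ω : Set (Space d)} (y : VSpace Ω) : incl Ω y ∈ V Ω :=
  Subtype.coe_prop (S := (V Ω : Set (H01 Ω))) y

/-- The form `(v y, w)` is defined and continuous for square integrable `v`. -/
theorem exists_trilinear (hd : d = 2 ∨ d = 3) {Ω : Set (Space d)}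
    (hΩb : Bornology.IsBounded Ω) :
    ∃ m : L2 Ω →L[ℝ] VSpace Ω →L[ℝ] VSpace Ω →L[ℝ] ℝ,
      ∀ v y w, m v y w = ∫ x in Ω, v x * ⟪field Ω (incl Ω y) x, field Ω (incl Ω w) x⟫ := by
  obtain ⟨E, hE⟩ := exists_embedding_four hd hΩb
  -- Since `1/4 + 1/4 = 1/2`, the pointwise inner product of two `L^4` fields lies in `L^2` and can
  -- be paired with `v`.
  let P : Lp (Space d) 4 (volume.restrict Ω) →L[ℝ] Lp (Space d) 4 (volume.restrict Ω) →L[ℝ] L2 Ω :=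
    ContinuousLinearMap.holderL (𝕜 := ℝ) (volume.restrict Ω) 4 4 2 (innerSL ℝ)
  let T : VSpace Ω →L[ℝ] VSpace Ω →L[ℝ] L2 Ω := P.bilinearComp (E.comp (incl Ω))
    (E.comp (incl Ω))
  let I : L2 Ω →L[ℝ] L2 Ω →L[ℝ] ℝ := innerSL ℝ
  refine ⟨((ContinuousLinearMap.compL ℝ (VSpace Ω) (VSpace Ω →L[ℝ] L2 Ω) (VSpace Ω →L[ℝ] ℝ)).flip T).comp
    ((ContinuousLinearMap.compL ℝ (VSpace Ω) (L2 Ω) ℝ).comp I), fun v y w => ?_⟩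
  change ⟪v, P (E (incl Ω y)) (E (incl Ω w))⟫ = _
  rw [L2.inner_def]
  refine integral_congr_ae ?_
  have hP := ContinuousLinearMap.coeFn_holder (𝕜 := ℝ) (r := 2) (innerSL ℝ) (E (incl Ω y))
    (E (incl Ω w))
  filter_upwards [hP, hE (incl Ω y), hE (incl Ω w)] with x hx hy hw
  rw [← hy, ← hw]
  have : P (E (incl Ω y)) (E (incl Ω w)) x = ⟪E (incl Ω y) x, E (incl Ω w) x⟫ := hx
  rw [this]
  exact mul_comm _ _

theorem form_symm {Ω : Set (Space d)} (u : LInf Ω) (y w : H01 Ω) : form u y w = form u w y := by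
  simp only [form, real_inner_comm]

/-- The state operator with square integrable coefficients. -/
theorem exists_stateOperator (hd : d = 2 ∨ d = 3) {Ω : Set (Space d)}
    [IsFiniteMeasure (volume.restrict Ω)] (hΩb : Bornology.IsBounded Ω) :
    ∃ (A₀ : VSpace Ω →L[ℝ] VSpace Ω →L[ℝ] ℝ) (m : L2 Ω →L[ℝ] VSpace Ω →L[ℝ] VSpace Ω →L[ℝ] ℝ),
      (∀ v y w, m v y w = ∫ x in Ω, v x * ⟪field Ω (incl Ω y) x, field Ω (incl Ω w) x⟫) ∧
      ∀ (u : LInf Ω) (y w : VSpace Ω), (A₀ + m (toL2 Ω u)) y w = form u (incl Ω y) (incl Ω w) := by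
  obtain ⟨m, hm⟩ := exists_trilinear hd hΩb
  let G := (grad Ω).comp (incl Ω)
  let A₀ : VSpace Ω →L[ℝ] VSpace Ω →L[ℝ] ℝ := (innerSL ℝ).bilinearComp G G
  refine ⟨A₀, m, hm, fun u y w => ?_⟩
  change A₀ y w + m (toL2 Ω u) y w = _
  rw [hm, form]
  refine congrArg₂ (· + ·) rfl (integral_congr_ae ?_)
  filter_upwards [coeFn_toL2 u] with x hx
  rw [hx]

/-- The state operator is an isomorphism if the coefficient has a positive lower bound. -/
theorem isInvertible_of_eq_form {Ω : Set (Space d)} {A : VSpace Ω →L[ℝ] VSpace Ω →L[ℝ] ℝ} {u : LInf Ω}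
    (hA : ∀ y w : VSpace Ω, A y w = form u (incl Ω y) (incl Ω w)) {c : ℝ} (hc : 0 < c)
    (hu : ∀ᵐ x ∂(volume.restrict Ω), c ≤ u x) : A.IsInvertible := by
  have hex : ∀ F : StrongDual ℝ (VSpace Ω), ∃! y : VSpace Ω, A y = F := by
    intro F
    -- Hahn–Banach: solvability is known for functionals on all of `H_0^1`, and only the restriction
    -- to `V` enters the equation.
    obtain ⟨F', hF', -⟩ := exists_extension_norm_eq (V Ω) F
    obtain ⟨y, hy, hy'⟩ := existsUnique_velocity u hc hu F'
    refine ⟨⟨y, hy.1⟩, ?_, fun z hz => ?_⟩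
    · refine ContinuousLinearMap.ext fun w => ?_
      exact (hA _ w).trans ((hy.2 _ (incl_mem w)).trans (hF' w))
    · refine Subtype.ext (hy' (incl Ω z) ⟨incl_mem z, fun w hw => ?_⟩)
      rw [hF' ⟨w, hw⟩, ← hz]
      exact (hA z ⟨w, hw⟩).symm
  have hinj : A.ker = ⊥ := LinearMap.ker_eq_bot.2 fun y z h => (hex (A z)).unique h rfl
  have hsurj : A.range = ⊤ := LinearMap.range_eq_top.2 fun F => (hex F).exists
  exact ⟨ContinuousLinearEquiv.ofBijective A hinj hsurj,
    ContinuousLinearEquiv.coe_ofBijective A hinj hsurj⟩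

/-- The velocity in terms of the inverse of the state operator. -/
theorem coe_inverse_apply_eq_velocity {Ω : Set (Space d)} {A : VSpace Ω →L[ℝ] VSpace Ω →L[ℝ] ℝ} {u : LInf Ω}
    (hA : ∀ y w : VSpace Ω, A y w = form u (incl Ω y) (incl Ω w)) {c : ℝ} (hc : 0 < c)
    (hu : ∀ᵐ x ∂(volume.restrict Ω), c ≤ u x) (F : StrongDual ℝ (H01 Ω)) :
    incl Ω (A.inverse (F.comp (incl Ω))) = velocity u F := by
  obtain ⟨e, he⟩ := isInvertible_of_eq_form hA hc hu
  refine (existsUnique_velocity u hc hu F).unique ⟨incl_mem _, fun w hw => ?_⟩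
    (isVelocity_velocity u hc hu F)
  have h : A (A.inverse (F.comp (incl Ω))) = F.comp (incl Ω) := by
    rw [← he, ContinuousLinearMap.inverse_equiv]
    exact e.apply_symm_apply _
  have h2 := congrArg (fun L : StrongDual ℝ (VSpace Ω) => L ⟨w, hw⟩) h
  exact (hA _ ⟨w, hw⟩).symm.trans h2

/-! ### Smooth dependence of the solution on the coefficient -/

section Inverse

variable {X H G : Type*} [NormedAddCommGroup X] [NormedSpace ℝ X] [NormedAddCommGroup H]
  [NormedSpace ℝ H] [CompleteSpace H] [NormedAddCommGroup G] [NormedSpace ℝ G]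
  {A₀ : H →L[ℝ] G} {m : X →L[ℝ] H →L[ℝ] G} {u : X}

theorem contDiffAt_inverse_add_apply (h : (A₀ + m u).IsInvertible) (F : G) {n : ℕ∞ω} :
    ContDiffAt ℝ n (fun v => (A₀ + m v).inverse F) u := by
  have hA : ContDiffAt ℝ n (fun v => A₀ + m v) u := (contDiff_const.add m.contDiff).contDiffAt
  exact (ContDiffAt.comp u h.contDiffAt_map_inverse hA).clm_apply contDiffAt_const

/-- This is the linearized state equation, the product rule applied to `(A₀ + m v) ((A₀ + m
v).inverse F) = F`. That identity holds near `u` because invertibility is an open condition. -/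
theorem apply_fderiv_inverse_add_apply (h : (A₀ + m u).IsInvertible) (F : G) (v : X) :
    (A₀ + m u) (fderiv ℝ (fun v => (A₀ + m v).inverse F) u v) + m v ((A₀ + m u).inverse F) = 0 := by
  have hA : HasFDerivAt (fun v => A₀ + m v) m u := m.hasFDerivAt.const_add A₀
  have hY := ((contDiffAt_inverse_add_apply h F (n := 1)).differentiableAt
    (by norm_num)).hasFDerivAt
  have heq : ∀ᶠ v in 𝓝 u, (A₀ + m v) ((A₀ + m v).inverse F) = F := by
    obtain ⟨e, he⟩ := h
    have h1 : ∀ᶠ T in 𝓝 (A₀ + m u), T.IsInvertible := by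
      rw [← he]
      exact e.nhds
    filter_upwards [hA.continuousAt.eventually h1] with v ⟨e', he'⟩
    rw [← he', ContinuousLinearMap.inverse_equiv]
    exact e'.apply_symm_apply _
  exact congrArg (fun L => L v)
    ((hA.clm_apply hY).unique ((hasFDerivAt_const F _).congr_of_eventuallyEq heq))

end Inverse

/-! ### The reduced cost on `L^2` and its gradient -/

/-- The derivative of a tracking functional. -/
theorem fderiv_tracking {X G : Type*} [NormedAddCommGroup X] [InnerProductSpace ℝ X]
    [NormedAddCommGroup G] [InnerProductSpace ℝ G] {S : X → G} {S' : X →L[ℝ] G} {u : X}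
    (hS : HasFDerivAt S S' u) (g : G) (α : ℝ) (v : X) :
    fderiv ℝ (fun v => 1 / 2 * ‖S v - g‖ ^ 2 + α / 2 * ‖v‖ ^ 2) u v
      = ⟪S u - g, S' v⟫ + α * ⟪u, v⟫ := by
  have h := (((hS.sub_const g).norm_sq).const_mul (1 / 2)).add
    (((hasFDerivAt_id u).norm_sq).const_mul (α / 2))
  have h' := congrArg (fun L => L v) h.fderiv
  refine Eq.trans h' ?_
  simp [inner_sub_left]
  ring

/-- An `L^∞` perturbation of norm below `c - c'` moves the values by less than `c - c'`. Thus the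
state equation stays uniquely solvable for controls near `u`, where `J` can be compared with `j`. -/
theorem eventually_le_of_le {Ω : Set (Space d)} {u : LInf Ω} {c c' : ℝ} (hc : c' < c)
    (hu : ∀ᵐ x ∂(volume.restrict Ω), c ≤ u x) :
    ∀ᶠ w in 𝓝 u, ∀ᵐ x ∂(volume.restrict Ω), c' ≤ w x := by
  filter_upwards [Metric.ball_mem_nhds u (sub_pos.2 hc)] with w hw
  rw [Metric.mem_ball, dist_eq_norm] at hw
  have h : ∀ᵐ x ∂(volume.restrict Ω), ‖(w - u) x‖ ≤ ‖w - u‖ := by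
    have h1 := enorm_ae_le_eLpNormEssSup (⇑(w - u)) (volume.restrict Ω)
    filter_upwards [h1] with x hx
    rw [← eLpNorm_exponent_top, ← Lp.enorm_def, enorm_le_iff_norm_le] at hx
    exact hx
  filter_upwards [h, hu, Lp.coeFn_sub w u] with x h1 h2 h3
  rw [h3, Pi.sub_apply, Real.norm_eq_abs] at h1
  linarith [(abs_le.1 h1).1]

/-- The reduced cost functional is the restriction of a functional on `L^2(Ω)` of class `C^2`. -/
theorem exists_extension_reducedCost (hd : d = 2 ∨ d = 3) {Ω : Set (Space d)}
    [IsFiniteMeasure (volume.restrict Ω)] (hΩb : Bornology.IsBounded Ω) (α : ℝ)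
    (f : StrongDual ℝ (H01 Ω)) (yΩ : VecL2 Ω) {u : LInf Ω} {c : ℝ} (hc : 0 < c)
    (hu : ∀ᵐ x ∂(volume.restrict Ω), c ≤ u x) :
    ∃ J : L2 Ω → ℝ, ContDiffAt ℝ 2 J (toL2 Ω u) ∧
      (∀ᶠ w in 𝓝 u, reducedCost α f yΩ w = J (toL2 Ω w)) ∧
      ∀ v, fderiv ℝ J (toL2 Ω u) v = α * ⟪toL2 Ω u, v⟫ -
        ∫ x in Ω, v x * ⟪field Ω (velocity u f) x, field Ω (adjointState f yΩ u) x⟫ := by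
  obtain ⟨A₀, m, hm, hA⟩ := exists_stateOperator hd hΩb
  let F : StrongDual ℝ (VSpace Ω) := f.comp (incl Ω)
  -- `Y` takes the default value 0 where the operator is not invertible; only its behaviour near
  -- `toL2 Ω u` matters.
  let Y : L2 Ω → VSpace Ω := fun v => (A₀ + m v).inverse F
  let E : VSpace Ω →L[ℝ] VecL2 Ω := (field Ω).comp (incl Ω)
  have hinv : (A₀ + m (toL2 Ω u)).IsInvertible := isInvertible_of_eq_form (hA u) hc hu
  have hY : ContDiffAt ℝ 2 Y (toL2 Ω u) := contDiffAt_inverse_add_apply hinv F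
  have hEY : ContDiffAt ℝ 2 (fun v => E (Y v) - yΩ) (toL2 Ω u) :=
    (E.contDiff.contDiffAt.comp (toL2 Ω u) hY).sub contDiffAt_const
  have hYv : ∀ {w : LInf Ω} {c : ℝ}, 0 < c → (∀ᵐ x ∂(volume.restrict Ω), c ≤ w x) →
      incl Ω (Y (toL2 Ω w)) = velocity w f :=
    fun {w} _ hc hw => coe_inverse_apply_eq_velocity (hA w) hc hw f
  refine ⟨fun v => 1 / 2 * ‖E (Y v) - yΩ‖ ^ 2 + α / 2 * ‖v‖ ^ 2,
    (contDiffAt_const.mul (hEY.norm_sq ℝ)).add (contDiffAt_const.mul (contDiffAt_id.norm_sq ℝ)),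
    ?_, fun v => ?_⟩
  · filter_upwards [eventually_le_of_le (half_lt_self hc) hu] with w hw
    have h1 : E (Y (toL2 Ω w)) = field Ω (velocity w f) :=
      congrArg (field Ω) (hYv (half_pos hc) hw)
    have h2 : ‖toL2 Ω w‖ ^ 2 = ∫ x in Ω, w x ^ 2 := by
      rw [← real_inner_self_eq_norm_sq (toL2 Ω w), L2.inner_def]
      refine integral_congr_ae ?_
      filter_upwards [coeFn_toL2 w] with x hx
      rw [hx, real_inner_self_eq_norm_sq, Real.norm_eq_abs, sq_abs]
    rw [h1, h2]
    rfl
  · have hEYd : HasFDerivAt (fun v => E (Y v)) (E.comp (fderiv ℝ Y (toL2 Ω u))) (toL2 Ω u) :=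
      E.hasFDerivAt.comp (toL2 Ω u) (hY.differentiableAt (by norm_num)).hasFDerivAt
    rw [fderiv_tracking hEYd]
    have hz := isVelocity_velocity u hc hu (ofField (field Ω (velocity u f) - yΩ))
    let z : VSpace Ω := ⟨adjointState f yΩ u, hz.1⟩
    -- Adjoint trick: the adjoint equation tested with `Y' v` and the linearized state equation
    -- tested with `z` share the same value of the symmetric form, so `Y' v` drops out of the
    -- derivative.
    have hadj : form u (incl Ω (fderiv ℝ Y (toL2 Ω u) v)) (incl Ω z)
        = ⟪field Ω (velocity u f) - yΩ, field Ω (incl Ω (fderiv ℝ Y (toL2 Ω u) v))⟫ :=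
      (form_symm _ _ _).trans (hz.2 _ (incl_mem _))
    have hlin : (A₀ + m (toL2 Ω u)) (fderiv ℝ Y (toL2 Ω u) v) z + m v (Y (toL2 Ω u)) z = 0 :=
      congrArg (fun L : StrongDual ℝ (VSpace Ω) => L z) (apply_fderiv_inverse_add_apply hinv F v)
    rw [hA, hadj, hm, hYv hc hu] at hlin
    have h1 : E (Y (toL2 Ω u)) = field Ω (velocity u f) := congrArg (field Ω) (hYv hc hu)
    rw [h1]
    change ⟪field Ω (velocity u f) - yΩ, field Ω (incl Ω (fderiv ℝ Y (toL2 Ω u) v))⟫ + _ = _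
    change _ + ∫ x in Ω, v x * ⟪field Ω (velocity u f) x, field Ω (adjointState f yΩ u) x⟫ = 0
      at hlin
    linarith

/-! ### Feasible directions and density in the critical cone -/

/-- Bounded directions that point into the admissible set with a uniform step size. -/
theorem eventually_add_smul_mem_admissible {Ω : Set (Space d)} {a b : ℝ} {u w : LInf Ω}
    {K ε : ℝ} (hε : 0 < ε) (hu : u ∈ admissible Ω a b)
    (hK : ∀ᵐ x ∂(volume.restrict Ω), |w x| ≤ K)
    (hw : ∀ᵐ x ∂(volume.restrict Ω), (u x < a + ε → 0 ≤ w x) ∧ (b - ε < u x → w x ≤ 0)) :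
    ∀ᶠ t in 𝓝[>] (0 : ℝ), u + t • w ∈ admissible Ω a b := by
  -- Once `t * K < ε`, a point at distance at least `ε` from a bound cannot cross it; at closer
  -- points the sign of `w` prevents crossing.
  have h0 : ∀ᶠ t in 𝓝[>] (0 : ℝ), t * K < ε := by
    refine Filter.Eventually.filter_mono nhdsWithin_le_nhds ?_
    have : Tendsto (fun t : ℝ => t * K) (𝓝 0) (𝓝 0) := by
      simpa using (tendsto_id (x := 𝓝 (0 : ℝ))).mul_const K
    exact this.eventually (eventually_lt_nhds hε)
  filter_upwards [h0, self_mem_nhdsWithin] with t ht htpos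
  have htpos' : 0 < t := htpos
  change ∀ᵐ x ∂(volume.restrict Ω), _
  filter_upwards [hu, hK, hw, Lp.coeFn_add u (t • w), Lp.coeFn_smul t w] with x h1 h2 h3 h4 h5
  rw [h4, Pi.add_apply, h5, Pi.smul_apply, smul_eq_mul]
  have h6 := abs_le.1 (abs_mul t (w x) ▸ mul_le_mul_of_nonneg_left h2 (abs_nonneg t))
  rw [abs_of_pos htpos'] at h6
  constructor
  · by_cases h : u x < a + ε
    · nlinarith [mul_nonneg htpos'.le (h3.1 h)]
    · linarith [h6.1]
  · by_cases h : b - ε < u x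
    · nlinarith [mul_nonneg htpos'.le (neg_nonneg.2 (h3.2 h))]
    · linarith [h6.2]

/-- The step `t • w` tends to 0 in `L^2`, so it ends up in the ball of local optimality. -/
theorem eventually_reducedCost_le {Ω : Set (Space d)} [IsFiniteMeasure (volume.restrict Ω)]
    {a b α : ℝ} {f : StrongDual ℝ (H01 Ω)} {yΩ : VecL2 Ω} {u w : LInf Ω}
    (hopt : IsLocallyOptimal a b α f yΩ u)
    (hw : ∀ᶠ t in 𝓝[>] (0 : ℝ), u + t • w ∈ admissible Ω a b) :
    ∀ᶠ t in 𝓝[>] (0 : ℝ), reducedCost α f yΩ u ≤ reducedCost α f yΩ (u + t • w) := by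
  obtain ⟨-, δ, hδ, h⟩ := hopt
  have h0 : ∀ᶠ t in 𝓝[>] (0 : ℝ), ‖toL2 Ω (t • w)‖ < δ := by
    refine Filter.Eventually.filter_mono nhdsWithin_le_nhds ?_
    have hc : Continuous fun t : ℝ => ‖toL2 Ω (t • w)‖ := by fun_prop
    exact (hc.tendsto' 0 0 (by simp)).eventually (eventually_lt_nhds hδ)
  filter_upwards [hw, h0] with t ht ht0
  refine h _ ht ?_
  rw [add_sub_cancel_left, ← eLpNorm_congr_ae (coeFn_toL2 (t • w)), ← Lp.enorm_def,
    ← ofReal_norm]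
  exact ENNReal.ofReal_le_ofReal ht0.le

/-- The critical directions that are bounded and vanish where the control is close to the bounds
without attaining them are dense in the critical cone. -/
theorem exists_seq_criticalCone {Ω : Set (Space d)} [IsFiniteMeasure (volume.restrict Ω)]
    {a b α : ℝ} (hab : a < b) {f : StrongDual ℝ (H01 Ω)} {yΩ : VecL2 Ω} {u : LInf Ω}
    (hu : u ∈ admissible Ω a b) {v : L2 Ω} (hv : v ∈ criticalCone a b α f yΩ u) :
    ∃ w : ℕ → LInf Ω, Tendsto (fun k => toL2 Ω (w k)) atTop (𝓝 v) ∧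
      ∀ k, toL2 Ω (w k) ∈ criticalCone a b α f yΩ u ∧
        ∀ᶠ t in 𝓝[>] (0 : ℝ), u + t • w k ∈ admissible Ω a b := by
  let ε : ℕ → ℝ := fun k => min ((k : ℝ) + 1)⁻¹ ((b - a) / 2)
  have hε : ∀ k, 0 < ε k := fun k => lt_min (by positivity) (by linarith)
  have hεlim : Tendsto (fun k : ℕ => ((k : ℝ) + 1)⁻¹) atTop (𝓝 0) := by
    simpa using tendsto_one_div_add_atTop_nhds_zero_nat (𝕜 := ℝ)
  have hvm := (Lp.aestronglyMeasurable v).aemeasurable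
  have hum := (Lp.aestronglyMeasurable u).aemeasurable
  -- Points where `u` lies strictly between a bound and its `ε k` margin are discarded, since
  -- criticality prescribes no sign of `v` from the bound there. Almost every point belongs to `s k`
  -- for all large `k`.
  let s : ℕ → Set (Space d) := fun k => {x | |v x| ≤ k} ∩
    (({x | u x = a} ∪ {x | a + ε k ≤ u x}) ∩ ({x | u x = b} ∪ {x | u x ≤ b - ε k}))
  have hs : ∀ k, NullMeasurableSet (s k) (volume.restrict Ω) := fun k =>
    (nullMeasurableSet_le hvm.abs aemeasurable_const).inter
      (((nullMeasurableSet_eq_fun hum aemeasurable_const).union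
        (nullMeasurableSet_le aemeasurable_const hum)).inter
        ((nullMeasurableSet_eq_fun hum aemeasurable_const).union
        (nullMeasurableSet_le hum aemeasurable_const)))
  obtain ⟨vk, hlim, hvk⟩ := exists_seq_tendsto_indicator v hs (by
    filter_upwards [hu] with x hx
    obtain ⟨n, hn⟩ := exists_nat_ge |v x|
    have h1 : ∀ᶠ k : ℕ in atTop, |v x| ≤ k := by
      filter_upwards [eventually_ge_atTop n] with k hk
      exact hn.trans (by exact_mod_cast hk)
    have h2 : ∀ᶠ k : ℕ in atTop, u x = a ∨ a + ε k ≤ u x := by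
      rcases hx.1.eq_or_lt with h | h
      · exact .of_forall fun k => .inl h.symm
      · filter_upwards [hεlim.eventually (eventually_lt_nhds (sub_pos.2 h))] with k hk
        exact .inr (by linarith [min_le_left ((k : ℝ) + 1)⁻¹ ((b - a) / 2)])
    have h3 : ∀ᶠ k : ℕ in atTop, u x = b ∨ u x ≤ b - ε k := by
      rcases hx.2.eq_or_lt with h | h
      · exact .of_forall fun k => .inl h
      · filter_upwards [hεlim.eventually (eventually_lt_nhds (sub_pos.2 h))] with k hk
        exact .inr (by linarith [min_le_left ((k : ℝ) + 1)⁻¹ ((b - a) / 2)])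
    filter_upwards [h1, h2, h3] with k k1 k2 k3
    exact ⟨k1, k2, k3⟩)
  have hbd : ∀ k, ∀ᵐ x ∂(volume.restrict Ω), |vk k x| ≤ k := fun k => by
    filter_upwards [hvk k] with x hx
    rw [hx, indicator_apply]
    split_ifs with h
    · exact h.1
    · simp
  have hm : ∀ k, MemLp (vk k) ∞ (volume.restrict Ω) := fun k =>
    memLp_top_of_bound (Lp.aestronglyMeasurable _) k (hbd k)
  have hcrit : ∀ k, vk k ∈ criticalCone a b α f yΩ u := fun k => by
    change ∀ᵐ x ∂(volume.restrict Ω), _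
    filter_upwards [hvk k, hv] with x hx hx2
    rw [hx, indicator_apply]
    split_ifs with h
    · exact hx2
    · simp
  refine ⟨fun k => (hm k).toLp, ?_, fun k => ⟨?_, ?_⟩⟩
  · simpa only [toL2_toLp (hm _) .rfl] using hlim
  · rw [toL2_toLp (hm k) .rfl]
    exact hcrit k
  · refine eventually_add_smul_mem_admissible (K := k) (hε k) hu ?_ ?_
    · filter_upwards [hbd k, (hm k).coeFn_toLp] with x h1 h2
      rwa [h2]
    · filter_upwards [hvk k, (hm k).coeFn_toLp, hv] with x h1 h2 h3
      rw [h2, h1, indicator_apply]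
      split_ifs with h
      · refine ⟨fun h4 => ?_, fun h4 => ?_⟩
        -- On `s k`, being closer than `ε k` to a bound means attaining it, so the sign condition of
        -- the cone applies.
        · exact h3.1 (h.2.1.resolve_right (not_le.2 h4))
        · exact h3.2.1 (h.2.2.resolve_right (not_le.2 h4))
      · simp

end Brinkman

end

/-! ### The second-order necessary condition -/

theorem mainTheorem5 (d : ℕ) (hd : d = 2 ∨ d = 3)
    (Ω : Set (Brinkman.Space d)) (hΩo : IsOpen Ω) (hΩb : Bornology.IsBounded Ω)
    (a b α : ℝ) (ha : 0 < a) (hab : a < b) (hα : 0 < α)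
    (f : StrongDual ℝ (Brinkman.H01 Ω)) (yΩ : Brinkman.VecL2 Ω)
    (ubar : Brinkman.LInf Ω) (hopt : Brinkman.IsLocallyOptimal a b α f yΩ ubar) :
    ContDiffAt ℝ 2 (Brinkman.reducedCost α f yΩ) ubar ∧
    (∃! B : Brinkman.L2 Ω →L[ℝ] Brinkman.L2 Ω →L[ℝ] ℝ,
      Brinkman.ExtendsSecondDeriv (Brinkman.reducedCost α f yΩ) ubar B) ∧
    ∀ B : Brinkman.L2 Ω →L[ℝ] Brinkman.L2 Ω →L[ℝ] ℝ,
      Brinkman.ExtendsSecondDeriv (Brinkman.reducedCost α f yΩ) ubar B →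
        ∀ v ∈ Brinkman.criticalCone a b α f yΩ ubar, 0 ≤ B v v := by
  have : IsFiniteMeasure (volume.restrict Ω) := ⟨by simpa using hΩb.measure_lt_top⟩
  have hadm := hopt.1
  obtain ⟨J, hJ, hj, hJ'⟩ := Brinkman.exists_extension_reducedCost hd hΩb α f yΩ ha
    (u := ubar) (by filter_upwards [hadm] with x hx using hx.1)
  have hB : ∀ v w, fderiv ℝ (fderiv ℝ (Brinkman.reducedCost α f yΩ)) ubar v w
      = fderiv ℝ (fderiv ℝ J) (Brinkman.toL2 Ω ubar) (Brinkman.toL2 Ω v) (Brinkman.toL2 Ω w) :=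
    Brinkman.fderiv_fderiv_comp_clm hJ hj
  have huniq : ∀ B : Brinkman.L2 Ω →L[ℝ] Brinkman.L2 Ω →L[ℝ] ℝ,
      Brinkman.ExtendsSecondDeriv (Brinkman.reducedCost α f yΩ) ubar B →
      B = fderiv ℝ (fderiv ℝ J) (Brinkman.toL2 Ω ubar) := by
    intro B hBe
    rw [Brinkman.extendsSecondDeriv_iff] at hBe
    have hdense := Brinkman.denseRange_toL2 Ω
    -- Density is used twice, once for each argument of the bilinear form.
    refine DFunLike.coe_injective (hdense.equalizer B.continuous
      (ContinuousLinearMap.continuous _) (funext fun v => ?_))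
    refine DFunLike.coe_injective (hdense.equalizer (ContinuousLinearMap.continuous _)
      (ContinuousLinearMap.continuous _) (funext fun w => ?_))
    exact (hBe v w).trans (hB v w)
  refine ⟨?_, ⟨_, Brinkman.extendsSecondDeriv_iff.2 fun v w => (hB v w).symm, huniq⟩, ?_⟩
  · exact (hJ.comp ubar (Brinkman.toL2 Ω).contDiff.contDiffAt).congr_of_eventuallyEq hj
  · intro B hBe v hv
    rw [huniq B hBe]
    obtain ⟨w, hlim, hw⟩ := Brinkman.exists_seq_criticalCone hab hadm hv
    set D := fderiv ℝ (fderiv ℝ J) (Brinkman.toL2 Ω ubar)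
    have hDc : Continuous fun v => D v v := D.continuous.clm_apply continuous_id
    refine ge_of_tendsto' ((hDc.tendsto v).comp hlim) fun k => ?_
    refine Brinkman.fderiv_fderiv_nonneg_of_eventually_le hJ ?_ ?_
    -- The integrand of `J'(ubar) w` vanishes pointwise: where `w ≠ 0`, criticality forces `α ubar =
    -- y·z`.
    · rw [hJ', L2.inner_def, ← integral_const_mul, sub_eq_zero]
      refine integral_congr_ae ?_
      filter_upwards [(hw k).1, Brinkman.coeFn_toL2 ubar] with x hx hx2
      rw [hx2]
      by_cases h : Brinkman.toL2 Ω (w k) x = 0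
      · simp [h]
      · have h1 := not_not.1 (mt hx.2.2 h)
        have h2 : ⟪ubar x, Brinkman.toL2 Ω (w k) x⟫ = Brinkman.toL2 Ω (w k) x * ubar x := rfl
        rw [h2, ← sub_eq_zero.1 h1]
        ring
    -- As `w k` is bounded, the segment approaches `ubar` in `L^∞`, where `J` coincides with the
    -- reduced cost and inherits its minimality.
    · have hcont : Tendsto (fun t : ℝ => ubar + t • w k) (𝓝[>] 0) (𝓝 ubar) := by
        have hc : Continuous fun t : ℝ => ubar + t • w k := by fun_prop
        exact (hc.tendsto' 0 ubar (by simp)).mono_left nhdsWithin_le_nhds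
      filter_upwards [Brinkman.eventually_reducedCost_le hopt (hw k).2, hcont.eventually hj]
        with t ht ht2
      rw [hj.self_of_nhds, ht2] at ht
      simpa using ht
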